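/- Let $\mu$ be a probability measure and $(\mathbf P_t)_{t\ge 0}$ a $\mu$-symmetric Markov semigroup, i.e. a strongly continuous semigroup of symmetric, positivity preserving operators on $L^2(\mu)$ with $\mathbf P_t 1=1$. Denote by $$\mathcal E(f,f)=\lim_{t\to 0^+}\frac 2t\int f\,(f-\mathbf P_t f)\,d\mu ,\qquad f\in\mathbb D,$$ its energy, $\mathbb D$ being the set of $f\in L^2(\mu)$ for which this limit exists and is finite. (With the generator $L$, $\mathcal E(f,f)=-2\int f\,Lf\,d\mu=\int\Gamma(f,f)\,d\mu$ for $\Gamma(f,f)=L(f^2)-2fLf$; it equals $\int|\nabla f|^2d\mu$ when $L=\frac12\Delta-\nabla U\cdot\nabla$.) Let $\tau:\mathbb R\to\mathbb R$ be a continuous even convex function with $\tau(0)=0$ and let $\tau^*(x)=\sup_y(xy-\tau(y))$ be its Legendre dual. Assume that $\tau^*(0)=0$, that $\tau(y)/y^2\to+\infty$ and $\tau(y)/y^p\to 0$ for every $p>2$ as $y\to+\infty$, that $\tau$ and $\tau^*$ satisfy the $\Delta_2$ condition ($\tau(2y)\le K\tau(y)$ for some $K>1$ and all large $y$, and likewise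 for $\tau^*$), that $\tau(1)+\tau^*(1)=1$, and that $\tau$ and $\tau^*$ are strictly increasing on $[0,\infty)$. Let $(\tau^*)^{-1}:[0,\infty)\to[0,\infty)$ be the inverse function of $\tau^*$ on $[0,\infty)$. Let $L_\tau(\mu)$ be the space of measurable $f$ with $\int\tau(f)\,d\mu<\infty$, with the gauge norm $N_\tau(f)=\inf\{k>0:\int\tau(f/k)\,d\mu\le\tau(1)\}$. For $f\in L^2(\mu)$ put $$\mathrm{Ent}_\tau(f)=\int f^2\log\left(\frac{(\tau^*)^{-1}\big(\tau^*(1)(f/\|f\|_2)^2\big)}{|f/\|f\|_2|}\right)d\mu ,$$ the integrand being $0$ where $f=0$. Assume that $y\mapsto y^2\log\big((\tau^*)^{-1}(\tau^*(1)y^2)/|y|\big)$ can be continuously extended up to the origin. Let $t_0>0$. If $\mathbf P_{t_0}$ maps $L^2(\mu)$ continuously into $(L_\tau(\mu),N_\tau)$, with operator norm $C(t_0,\tau)$ (that is, the semigroup is $\tau$-Orlicz hyperbounded), then for every $f\in\mathbb D$ the integrand of $\mathrm{Ent}_\tau(f)$ is integrable and $$\mathrm{Ent}_\tau(f)\le\frac{t_0}{2}\,\mathcal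 E(f,f)+\log\big(C(t_0,\tau)\big)\,\|f\|_2^2 .$$ In particular, if $\mathbf P_{t_0}$ is a contraction from $L^2(\mu)$ into $(L_\tau(\mu),N_\tau)$ (that is, the semigroup is $\tau$-Orlicz hypercontractive), then for every $f\in\mathbb D$ $$\mathrm{Ent}_\tau(f)\le\frac{t_0}{2}\,\mathcal E(f,f).$$ -/

import Mathlib

open MeasureTheory Filter Topology
open scoped ENNReal RealInnerProductSpace

noncomputable section

namespace OrliczSobolev

/-- The Fenchel–Legendre dual `τ*(x) = sup_y (x y - τ(y))`.  For a Young function with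
`τ(y)/y² → ∞` the supremum is finite. -/
def dual (τ : ℝ → ℝ) (x : ℝ) : ℝ := ⨆ y : ℝ, (x * y - τ y)

/-- The `Δ₂` condition (for large arguments). -/
def DeltaTwo (τ : ℝ → ℝ) : Prop :=
  ∃ K : ℝ, 1 < K ∧ ∃ y₁ : ℝ, 0 ≤ y₁ ∧ ∀ y, y₁ ≤ y → τ (2 * y) ≤ K * τ y

/-- Standing assumptions on a normalized complementary pair `(τ*, τ)` of continuous even Young
functions, `τ* = dual τ`, that are increasing on `[0, ∞)`.  The growth conditions say that `τ`
grows faster than `y²` but slower than every `y^p` with `p > 2`. -/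
structure IsAdmissibleYoung (τ : ℝ → ℝ) : Prop where
  convex : ConvexOn ℝ Set.univ τ
  continuous : Continuous τ
  even : ∀ y, τ (-y) = τ y
  map_zero : τ 0 = 0
  dual_zero : dual τ 0 = 0
  superquadratic : Tendsto (fun y : ℝ => τ y / y ^ 2) atTop atTop
  subpower : ∀ p : ℝ, 2 < p → Tendsto (fun y : ℝ => τ y / y ^ p) atTop (𝓝 0)
  deltaTwo : DeltaTwo τ
  dual_deltaTwo : DeltaTwo (dual τ)
  normalized : τ 1 + dual τ 1 = 1
  strictMono : StrictMonoOn τ (Set.Ici 0)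
  dual_strictMono : StrictMonoOn (dual τ) (Set.Ici 0)

/-- The inverse function `(τ*)⁻¹ : [0, ∞) → [0, ∞)` of the dual Young function. -/
def dualInv (τ : ℝ → ℝ) (s : ℝ) : ℝ := Function.invFunOn (dual τ) (Set.Ici 0) s

section Space

variable {Ω : Type*} [MeasurableSpace Ω] (μ : Measure Ω)

/-- The modular `I_τ(f) = ∫ τ(f) dμ ∈ [0, ∞]` (for a nonnegative function `τ`). -/
def modular (τ : ℝ → ℝ) (f : Ω → ℝ) : ℝ≥0∞ := ∫⁻ x, ENNReal.ofReal (τ (f x)) ∂μ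

/-- `f` belongs to the Orlicz space `L_τ(μ)`. -/
def MemOrlicz (τ : ℝ → ℝ) (f : Ω → ℝ) : Prop :=
  AEMeasurable f μ ∧ modular μ τ f < ∞

/-- The gauge (Luxemburg) norm `N_τ(f) = inf {k > 0 ; I_τ(f/k) ≤ τ(1)}`, with `inf ∅ = ∞`. -/
def gaugeNorm (τ : ℝ → ℝ) (f : Ω → ℝ) : ℝ≥0∞ :=
  sInf {c | ∃ k : ℝ, 0 < k ∧ modular μ τ (fun x => f x / k) ≤ ENNReal.ofReal (τ 1) ∧
    c = ENNReal.ofReal k}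

variable {μ}

/-- The operator norm from `L²(μ)` to `(L_τ(μ), N_τ)`, in `[0, ∞]`. -/
def orliczOpNorm (τ : ℝ → ℝ) (T : Lp ℝ 2 μ →L[ℝ] Lp ℝ 2 μ) : ℝ≥0∞ :=
  sInf {C | ∀ f : Lp ℝ 2 μ, gaugeNorm μ τ (T f) ≤ C * ENNReal.ofReal ‖f‖}

variable (μ) in
/-- A `μ`-symmetric (conservative) Markov semigroup `(P_t)_{t ≥ 0}`, acting on `L²(μ)`, for a
probability measure `μ`.  The operators with negative index play no role. -/
structure SymmetricMarkovSemigroup [IsProbabilityMeasure μ] where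
  /-- the operators `P_t` -/
  op : ℝ → Lp ℝ 2 μ →L[ℝ] Lp ℝ 2 μ
  op_zero : op 0 = ContinuousLinearMap.id ℝ (Lp ℝ 2 μ)
  op_add : ∀ s t, 0 ≤ s → 0 ≤ t → op (s + t) = (op s).comp (op t)
  symmetric : ∀ t, 0 ≤ t → ∀ f g : Lp ℝ 2 μ, ⟪op t f, g⟫ = ⟪f, op t g⟫
  positive : ∀ t, 0 ≤ t → ∀ f : Lp ℝ 2 μ, 0 ≤ f → 0 ≤ op t f
  conservative : ∀ t, 0 ≤ t → op t (Lp.const 2 μ (1 : ℝ)) = Lp.const 2 μ (1 : ℝ)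
  strongly_continuous : ∀ f : Lp ℝ 2 μ, Tendsto (fun t => op t f) (𝓝[>] 0) (𝓝 f)

namespace SymmetricMarkovSemigroup

variable [IsProbabilityMeasure μ] (P : SymmetricMarkovSemigroup μ)

/-- The difference quotient `(2/t) ⟨f - P_t f, f⟩` approximating the energy. -/
def approxEnergy (f : Lp ℝ 2 μ) (t : ℝ) : ℝ := 2 / t * ⟪f - P.op t f, f⟫

/-- The domain of the Dirichlet form: those `f ∈ L²(μ)` for which the approximating energies have
a finite limit.  It contains the domain of the generator, hence every core. -/
def energyDomain : Set (Lp ℝ 2 μ) :=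
  {f | ∃ e : ℝ, Tendsto (P.approxEnergy f) (𝓝[>] 0) (𝓝 e)}

/-- The energy `𝓔(f, f) = lim_{t → 0+} (2/t) ⟨f - P_t f, f⟩`.  With the generator `L`, it is
`-2 ∫ f L f dμ = ∫ Γ(f, f) dμ` for `Γ(f, f) = L(f²) - 2 f L f`; it is `∫ |∇f|² dμ` when
`L = (1/2) Δ - ∇U · ∇`. -/
def energy (f : Lp ℝ 2 μ) : ℝ := limUnder (𝓝[>] 0) (P.approxEnergy f)

/-- `P_t` is a continuous mapping from `L²(μ)` into `(L_τ(μ), N_τ)`. -/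
def OrliczHyperboundedAt (τ : ℝ → ℝ) (t : ℝ) : Prop :=
  (∀ f : Lp ℝ 2 μ, MemOrlicz μ τ (P.op t f)) ∧ orliczOpNorm τ (P.op t) < ∞

/-- `P_t` is a contraction from `L²(μ)` into `(L_τ(μ), N_τ)`. -/
def OrliczHypercontractiveAt (τ : ℝ → ℝ) (t : ℝ) : Prop :=
  (∀ f : Lp ℝ 2 μ, MemOrlicz μ τ (P.op t f)) ∧
    ∀ f : Lp ℝ 2 μ, gaugeNorm μ τ (P.op t f) ≤ ENNReal.ofReal ‖f‖

end SymmetricMarkovSemigroup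

/-- The weight `log ((τ*)⁻¹(τ*(1) y²) / |y|)`. -/
def logWeight (τ : ℝ → ℝ) (y : ℝ) : ℝ :=
  Real.log (dualInv τ (dual τ 1 * y ^ 2) / |y|)

/-- The integrand `f² log ((τ*)⁻¹(τ*(1) (f/‖f‖₂)²) / |f/‖f‖₂|)` of the `τ`-entropy; it is `0`
where `f` vanishes. -/
def entIntegrand (τ : ℝ → ℝ) (f : Lp ℝ 2 μ) (x : Ω) : ℝ :=
  f x ^ 2 * logWeight τ (f x / ‖f‖)

/-- The `τ`-entropy `Ent_τ(f)`. -/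
def tauEntropy (τ : ℝ → ℝ) (f : Lp ℝ 2 μ) : ℝ := ∫ x, entIntegrand τ f x ∂μ

end Space

end OrliczSobolev

end

namespace OrliczSobolev

namespace IsAdmissibleYoung

variable {τ : ℝ → ℝ}

theorem nonneg (hτ : IsAdmissibleYoung τ) (y : ℝ) : 0 ≤ τ y := by
  have key : ∀ y, 0 ≤ y → 0 ≤ τ y := fun y hy => by
    have := hτ.strictMono.monotoneOn (Set.mem_Ici.2 le_rfl) (Set.mem_Ici.2 hy) hy
    rwa [hτ.map_zero] at this
  rcases le_total 0 y with h | h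
  · exact key y h
  · rw [← hτ.even]
    exact key _ (by linarith)

theorem exists_mul_sub_le (hτ : IsAdmissibleYoung τ) :
    ∃ R : ℝ, 0 ≤ R ∧ ∀ x y : ℝ, x * y - τ y ≤ x ^ 2 / 4 + |x| * R := by
  obtain ⟨R₀, hR₀⟩ := eventually_atTop.1 (hτ.superquadratic.eventually_ge_atTop 1)
  refine ⟨max R₀ 1, by positivity, fun x y => ?_⟩
  have habs : τ y = τ |y| := by
    rcases abs_choice y with h | h <;> rw [h]
    rw [hτ.even]
  rcases le_total (max R₀ 1) |y| with h | h
  · have h1 := hR₀ |y| ((le_max_left _ _).trans h)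
    have hy : 0 < |y| := lt_of_lt_of_le one_pos ((le_max_right _ _).trans h)
    rw [le_div_iff₀ (by positivity), sq_abs, ← habs] at h1
    have : 0 ≤ |x| * max R₀ 1 := by positivity
    nlinarith [sq_nonneg (x / 2 - y)]
  · have h1 := hτ.nonneg y
    have h2 : x * y ≤ |x| * |y| := by rw [← abs_mul]; exact le_abs_self _
    have h3 := mul_le_mul_of_nonneg_left h (abs_nonneg x)
    nlinarith [sq_nonneg x]

theorem bddAbove (hτ : IsAdmissibleYoung τ) (x : ℝ) :
    BddAbove (Set.range fun y : ℝ => x * y - τ y) := by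
  obtain ⟨R, -, hR⟩ := hτ.exists_mul_sub_le
  exact ⟨_, Set.forall_mem_range.2 fun y => hR x y⟩

theorem young (hτ : IsAdmissibleYoung τ) (x y : ℝ) : x * y ≤ τ y + dual τ x := by
  have := le_ciSup (hτ.bddAbove x) y
  simp only [dual]
  linarith

theorem convexOn_dual (hτ : IsAdmissibleYoung τ) : ConvexOn ℝ Set.univ (dual τ) := by
  refine ⟨convex_univ, fun x _ z _ a b ha hb hab => ciSup_le fun y => ?_⟩
  have h1 := mul_le_mul_of_nonneg_left (hτ.young x y) ha
  have h2 := mul_le_mul_of_nonneg_left (hτ.young z y) hb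
  simp only [smul_eq_mul]
  have : τ y = a * τ y + b * τ y := by rw [← add_mul, hab, one_mul]
  linarith

theorem continuous_dual (hτ : IsAdmissibleYoung τ) : Continuous (dual τ) :=
  continuousOn_univ.1 (hτ.convexOn_dual.continuousOn isOpen_univ)

theorem dual_one_pos (hτ : IsAdmissibleYoung τ) : 0 < dual τ 1 := by
  have := hτ.dual_strictMono (Set.mem_Ici.2 le_rfl) (Set.mem_Ici.2 zero_le_one) one_pos
  rwa [hτ.dual_zero] at this

theorem exists_dual_eq (hτ : IsAdmissibleYoung τ) {s : ℝ} (hs : 0 ≤ s) :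
    ∃ x ∈ Set.Ici (0 : ℝ), dual τ x = s := by
  have h1 := hτ.young (s + τ 1) 1
  have h0 : 0 ≤ s + τ 1 := add_nonneg hs (hτ.nonneg 1)
  obtain ⟨x, hx, hxs⟩ := intermediate_value_Icc h0 hτ.continuous_dual.continuousOn
    (show s ∈ Set.Icc (dual τ 0) (dual τ (s + τ 1)) from
      ⟨by rwa [hτ.dual_zero], by linarith⟩)
  exact ⟨x, hx.1, hxs⟩

theorem dual_dualInv (hτ : IsAdmissibleYoung τ) {s : ℝ} (hs : 0 ≤ s) :
    dual τ (dualInv τ s) = s :=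
  Function.invFunOn_eq (hτ.exists_dual_eq hs)

theorem dualInv_nonneg (hτ : IsAdmissibleYoung τ) {s : ℝ} (hs : 0 ≤ s) : 0 ≤ dualInv τ s :=
  Function.invFunOn_mem (hτ.exists_dual_eq hs)

theorem dualInv_le_dualInv (hτ : IsAdmissibleYoung τ) {s t : ℝ} (hs : 0 ≤ s) (hst : s ≤ t) :
    dualInv τ s ≤ dualInv τ t := by
  have ht := hs.trans hst
  rw [← hτ.dual_strictMono.le_iff_le (hτ.dualInv_nonneg hs) (hτ.dualInv_nonneg ht),
    hτ.dual_dualInv hs, hτ.dual_dualInv ht]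
  exact hst

theorem dualInv_pos (hτ : IsAdmissibleYoung τ) {s : ℝ} (hs : 0 < s) : 0 < dualInv τ s := by
  refine (hτ.dualInv_nonneg hs.le).lt_of_ne fun h => hs.ne ?_
  rw [← hτ.dual_dualInv hs.le, ← h, hτ.dual_zero]

theorem dualInv_dual_one (hτ : IsAdmissibleYoung τ) : dualInv τ (dual τ 1) = 1 :=
  hτ.dual_strictMono.injOn (hτ.dualInv_nonneg hτ.dual_one_pos.le) (Set.mem_Ici.2 zero_le_one)
    (hτ.dual_dualInv hτ.dual_one_pos.le)

theorem measurable_logWeight (hτ : IsAdmissibleYoung τ) : Measurable (logWeight τ) := by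
  have h1 : Measurable fun s : ℝ => dualInv τ (max s 0) :=
    Monotone.measurable fun s t hst =>
      hτ.dualInv_le_dualInv (le_max_right _ _) (max_le_max hst le_rfl)
  have h2 : (fun y : ℝ => dualInv τ (dual τ 1 * y ^ 2)) =
      fun y => dualInv τ (max (dual τ 1 * y ^ 2) 0) := by
    funext y
    rw [max_eq_left (mul_nonneg hτ.dual_one_pos.le (sq_nonneg y))]
  have h3 : Measurable fun y : ℝ => dualInv τ (dual τ 1 * y ^ 2) := by
    rw [h2]
    exact h1.comp (by fun_prop)
  unfold logWeight
  exact Real.measurable_log.comp (h3.div (by fun_prop))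

theorem mul_exp_logWeight (hτ : IsAdmissibleYoung τ) {y : ℝ} (hy : 0 < y) :
    y * Real.exp (logWeight τ y) = dualInv τ (dual τ 1 * y ^ 2) := by
  have h := hτ.dualInv_pos (mul_pos hτ.dual_one_pos (pow_pos hy 2))
  rw [logWeight, abs_of_pos hy, Real.exp_log (div_pos h hy)]
  field_simp

theorem log_le_logWeight (hτ : IsAdmissibleYoung τ) {y : ℝ} (hy : 0 < y) (hy1 : y ≤ 1) :
    Real.log y ≤ logWeight τ y := by
  have hd := hτ.dual_one_pos
  have hs : 0 < dual τ 1 * y ^ 2 := mul_pos hd (pow_pos hy 2)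
  set h := dualInv τ (dual τ 1 * y ^ 2) with hh
  have hpos : 0 < h := hτ.dualInv_pos hs
  have hle : h ≤ 1 := by
    rw [← hτ.dualInv_dual_one]
    exact hτ.dualInv_le_dualInv hs.le (mul_le_of_le_one_right hd.le (pow_le_one₀ hy.le hy1))
  have hconv := hτ.convexOn_dual.2 (Set.mem_univ (0 : ℝ)) (Set.mem_univ (1 : ℝ))
    (sub_nonneg.2 hle) hpos.le (by ring)
  simp only [smul_eq_mul, mul_zero, mul_one, zero_add, hτ.dual_zero] at hconv
  rw [hh, hτ.dual_dualInv hs.le, ← hh] at hconv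
  have hsq : y ^ 2 ≤ h := le_of_mul_le_mul_left (by linarith) hd
  rw [logWeight, abs_of_pos hy]
  refine Real.log_le_log hy ?_
  rw [le_div_iff₀ hy]
  nlinarith

theorem exists_le_logWeight (hτ : IsAdmissibleYoung τ) :
    ∃ K : ℝ, 0 ≤ K ∧ ∀ y : ℝ, 1 ≤ y → -K ≤ logWeight τ y := by
  obtain ⟨R, hR, hb⟩ := hτ.exists_mul_sub_le
  have hd := hτ.dual_one_pos
  set c := dual τ 1 / (1 / 4 + R) with hc
  have hcpos : 0 < c := by positivity
  refine ⟨|Real.log (Real.sqrt c)|, abs_nonneg _, fun y hy => ?_⟩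
  have hy0 : 0 < y := by linarith
  have hs : 0 < dual τ 1 * y ^ 2 := mul_pos hd (pow_pos hy0 2)
  set h := dualInv τ (dual τ 1 * y ^ 2) with hh
  have hge : 1 ≤ h := by
    rw [← hτ.dualInv_dual_one]
    exact hτ.dualInv_le_dualInv hd.le (le_mul_of_one_le_right hd.le (one_le_pow₀ hy))
  have hpos : 0 < h := by linarith
  have hdual : dual τ h ≤ h ^ 2 / 4 + |h| * R := ciSup_le fun z => hb h z
  rw [hh, hτ.dual_dualInv hs.le, ← hh, abs_of_pos hpos] at hdual
  have h2 : dual τ 1 * y ^ 2 ≤ (1 / 4 + R) * h ^ 2 := by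
    have h5 : h * R ≤ h ^ 2 * R := mul_le_mul_of_nonneg_right (by nlinarith) hR
    linarith
  have h3 : c * y ^ 2 ≤ h ^ 2 := by
    rw [hc, div_mul_eq_mul_div, div_le_iff₀ (by positivity)]
    linarith
  have h4 : Real.sqrt c ≤ h / y := by
    rw [Real.sqrt_le_left (by positivity), div_pow, le_div_iff₀ (by positivity)]
    exact h3
  refine (neg_abs_le _).trans ?_
  rw [logWeight, abs_of_pos hy0]
  exact Real.log_le_log (Real.sqrt_pos.2 hcpos) h4

/-- The negative part of the weight is harmless against `y`. -/
theorem exists_le_mul_min_logWeight (hτ : IsAdmissibleYoung τ) :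
    ∃ K : ℝ, 0 ≤ K ∧ ∀ y : ℝ, 0 ≤ y → -(K * y + 1) ≤ y * min (logWeight τ y) 0 := by
  obtain ⟨K, hK, hb⟩ := hτ.exists_le_logWeight
  refine ⟨K, hK, fun y hy => ?_⟩
  rcases hy.eq_or_lt with rfl | hy
  · simp
  rcases le_total y 1 with h | h
  · have h1 : Real.log y ≤ min (logWeight τ y) 0 :=
      le_min (hτ.log_le_logWeight hy h) (Real.log_nonpos hy.le h)
    have h2 := Real.log_le_sub_one_of_pos (inv_pos.2 hy)
    rw [Real.log_inv] at h2
    have h3 : y * (-Real.log y) ≤ y * (y⁻¹ - 1) := mul_le_mul_of_nonneg_left h2 hy.le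
    rw [mul_sub, mul_inv_cancel₀ hy.ne'] at h3
    nlinarith [mul_le_mul_of_nonneg_left h1 hy.le]
  · have h1 : -K ≤ min (logWeight τ y) 0 := le_min (hb y h) (by linarith)
    nlinarith [mul_le_mul_of_nonneg_left h1 hy.le]

theorem abs_mul_min_logWeight_le {K : ℝ}
    (hK : ∀ y : ℝ, 0 ≤ y → -(K * y + 1) ≤ y * min (logWeight τ y) 0) (hK0 : 0 ≤ K)
    {M y : ℝ} (hM : 0 ≤ M) (hy : 0 ≤ y) :
    |y * min (logWeight τ y) M| ≤ (K + M) * y + 1 := by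
  have h1 : y * min (logWeight τ y) 0 ≤ y * min (logWeight τ y) M := by gcongr
  have h2 : y * min (logWeight τ y) M ≤ y * M := by gcongr; exact min_le_right _ _
  have h3 := hK y hy
  have := mul_nonneg hK0 hy
  have := mul_nonneg hM hy
  rw [abs_le]
  constructor <;> nlinarith

end IsAdmissibleYoung

variable {Ω : Type*} [MeasurableSpace Ω] {μ : Measure Ω}

theorem inner_eq_integral_mul (f g : Lp ℝ 2 μ) : ⟪f, g⟫ = ∫ x, f x * g x ∂μ := by
  rw [L2.inner_def]
  refine integral_congr_ae (Eventually.of_forall fun x => ?_)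
  simp [mul_comm]

theorem integrable_coe_mul_coe (f g : Lp ℝ 2 μ) : Integrable (fun x => f x * g x) μ := by
  have := L2.integrable_inner (𝕜 := ℝ) f g
  refine this.congr (Eventually.of_forall fun x => ?_)
  simp [mul_comm]

theorem inner_le_inner_of_ae {f g h k : Lp ℝ 2 μ} (hle : ∀ᵐ x ∂μ, f x * g x ≤ h x * k x) :
    ⟪f, g⟫ ≤ ⟪h, k⟫ := by
  rw [inner_eq_integral_mul, inner_eq_integral_mul]
  exact integral_mono_ae (integrable_coe_mul_coe f g) (integrable_coe_mul_coe h k) hle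

theorem inner_le_inner_right {f g h : Lp ℝ 2 μ} (hf : 0 ≤ f) (hgh : g ≤ h) :
    ⟪f, g⟫ ≤ ⟪f, h⟫ := by
  refine inner_le_inner_of_ae ?_
  filter_upwards [(Lp.coeFn_nonneg f).2 hf, (Lp.coeFn_le g h).2 hgh] with x hx hx'
  exact mul_le_mul_of_nonneg_left hx' hx

theorem memLp_mul_exp {v : Ω → ℝ} {M : ℝ} (hv : Measurable v) (hM : ∀ x, v x ≤ M) {s : ℝ} (hs : 0 ≤ s)
    (F : Lp ℝ 2 μ) : MemLp (fun x => F x * Real.exp (s * v x)) 2 μ := by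
  refine MemLp.of_le_mul (c := Real.exp (s * M)) (Lp.memLp F)
    ((Lp.aestronglyMeasurable F).mul (by fun_prop)) (Eventually.of_forall fun x => ?_)
  rw [norm_mul, mul_comm, Real.norm_of_nonneg (Real.exp_pos _).le]
  gcongr
  exact hM x

namespace SymmetricMarkovSemigroup

variable [IsProbabilityMeasure μ] (P : SymmetricMarkovSemigroup μ)

theorem monotone_op {t : ℝ} (ht : 0 ≤ t) {f g : Lp ℝ 2 μ} (hfg : f ≤ g) :
    P.op t f ≤ P.op t g := by
  have := P.positive t ht (g - f) (sub_nonneg.2 hfg)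
  rwa [map_sub, sub_nonneg] at this

/-- Cauchy–Schwarz for the (formal) kernel of `P_t`: `⟨P_t √(ab), √(ab)⟩ ≤ ⟨P_t a, b⟩`. -/
theorem inner_op_sqrt_le {t : ℝ} (ht : 0 ≤ t) {a b u : Lp ℝ 2 μ} (ha : 0 ≤ a) (hb : 0 ≤ b)
    (hu : 0 ≤ u) (h : ∀ᵐ x ∂μ, u x ^ 2 = a x * b x) :
    ⟪P.op t u, u⟫ ≤ ⟪P.op t a, b⟫ := by
  have ha' := (Lp.coeFn_nonneg a).2 ha
  have hb' := (Lp.coeFn_nonneg b).2 hb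
  have hu' := (Lp.coeFn_nonneg u).2 hu
  have key : ∀ r s : ℝ, 0 ≤ r → 0 ≤ s →
      ∀ᵐ x ∂μ, 2 * (r * s) * P.op t u x ≤ r ^ 2 * P.op t a x + s ^ 2 * P.op t b x := by
    intro r s hr hs
    have hle : (2 * (r * s)) • u ≤ r ^ 2 • a + s ^ 2 • b := by
      rw [← Lp.coeFn_le]
      filter_upwards [Lp.coeFn_smul (2 * (r * s)) u, Lp.coeFn_add (r ^ 2 • a) (s ^ 2 • b),
        Lp.coeFn_smul (r ^ 2) a, Lp.coeFn_smul (s ^ 2) b, ha', hb', hu', h]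
        with x h1 h2 h3 h4 hax hbx hux hx
      simp only [Pi.zero_apply] at hax hbx hux
      rw [h1, h2, Pi.add_apply, h3, h4]
      simp only [Pi.smul_apply, smul_eq_mul]
      have hsa := Real.sq_sqrt hax
      have hsb := Real.sq_sqrt hbx
      have hux' : u x = √(a x) * √(b x) := by
        rw [← Real.sqrt_mul hax, ← hx, Real.sqrt_sq hux]
      rw [hux']
      nlinarith [sq_nonneg (r * √(a x) - s * √(b x))]
    have hP := P.monotone_op ht hle
    rw [map_add, map_smul, map_smul, map_smul, ← Lp.coeFn_le] at hP
    filter_upwards [hP, Lp.coeFn_smul (2 * (r * s)) (P.op t u),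
      Lp.coeFn_add (r ^ 2 • P.op t a) (s ^ 2 • P.op t b),
      Lp.coeFn_smul (r ^ 2) (P.op t a), Lp.coeFn_smul (s ^ 2) (P.op t b)] with x h0 h1 h2 h3 h4
    rw [h1, h2, Pi.add_apply, h3, h4] at h0
    simpa only [Pi.smul_apply, smul_eq_mul] using h0
  have hall : ∀ᵐ x ∂μ, ∀ q : ℚ × ℚ,
      2 * (|(q.1 : ℝ)| * |(q.2 : ℝ)|) * P.op t u x ≤
        |(q.1 : ℝ)| ^ 2 * P.op t a x + |(q.2 : ℝ)| ^ 2 * P.op t b x :=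
    ae_all_iff.2 fun q => key _ _ (abs_nonneg _) (abs_nonneg _)
  have hpt : ∀ᵐ x ∂μ, 2 * (u x * P.op t u x) ≤ b x * P.op t a x + a x * P.op t b x := by
    filter_upwards [hall, ha', hb', hu', h] with x hq hax hbx hux hx
    simp only [Pi.zero_apply] at hax hbx hux
    have hreal : ∀ p : ℝ × ℝ, 2 * (|p.1| * |p.2|) * P.op t u x ≤
        |p.1| ^ 2 * P.op t a x + |p.2| ^ 2 * P.op t b x := by
      have hd : DenseRange (Prod.map ((↑) : ℚ → ℝ) ((↑) : ℚ → ℝ)) :=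
        Rat.denseRange_cast.prodMap Rat.denseRange_cast
      intro p
      refine hd.induction_on (p := fun p : ℝ × ℝ => 2 * (|p.1| * |p.2|) * P.op t u x ≤
        |p.1| ^ 2 * P.op t a x + |p.2| ^ 2 * P.op t b x) p ?_ fun q => hq q
      exact isClosed_le (by fun_prop) (by fun_prop)
    have h1 := hreal (√(b x), √(a x))
    simp only [abs_of_nonneg (Real.sqrt_nonneg _), Real.sq_sqrt hax, Real.sq_sqrt hbx] at h1
    have hux' : u x = √(b x) * √(a x) := by
      rw [← Real.sqrt_mul hbx, mul_comm, ← hx, Real.sqrt_sq hux]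
    rw [hux', ← mul_assoc]
    exact h1
  have hint := integral_mono_ae ((integrable_coe_mul_coe u (P.op t u)).const_mul 2)
    ((integrable_coe_mul_coe b (P.op t a)).add (integrable_coe_mul_coe a (P.op t b))) hpt
  simp only [Pi.add_apply] at hint
  rw [integral_const_mul, integral_add (integrable_coe_mul_coe _ _) (integrable_coe_mul_coe _ _),
    ← inner_eq_integral_mul, ← inner_eq_integral_mul, ← inner_eq_integral_mul,
    ← P.symmetric t ht a b, real_inner_comm, real_inner_comm (P.op t a)] at hint
  linarith

theorem inner_op_le_inner_op_abs {t : ℝ} (ht : 0 ≤ t) (f : Lp ℝ 2 μ) :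
    ⟪P.op t f, f⟫ ≤ ⟪P.op t |f|, |f|⟫ := by
  refine inner_le_inner_of_ae ?_
  have h1 := P.monotone_op ht (le_abs_self f)
  have h2 := P.monotone_op ht (neg_le_abs f)
  rw [map_neg] at h2
  filter_upwards [(Lp.coeFn_le _ _).2 h1, (Lp.coeFn_le _ _).2 h2, Lp.coeFn_abs f,
    Lp.coeFn_neg (P.op t f)] with x h1 h2 h3 h4
  rw [h4, Pi.neg_apply] at h2
  rw [h3]
  calc P.op t f x * f x ≤ |P.op t f x| * |f x| := by rw [← abs_mul]; exact le_abs_self _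
    _ ≤ _ := mul_le_mul_of_nonneg_right (abs_le'.2 ⟨h1, h2⟩) (abs_nonneg _)

theorem inner_op_add_self (f g : Lp ℝ 2 μ) {t : ℝ} (ht : 0 ≤ t) :
    ⟪P.op (t + t) f, g⟫ = ⟪P.op t f, P.op t g⟫ := by
  rw [P.op_add t t ht ht, ContinuousLinearMap.comp_apply, P.symmetric t ht]

variable {F : Lp ℝ 2 μ} {v : Ω → ℝ} {M : ℝ}

/-- Interpolation between times `0` and `t₀` at the dyadic points `2⁻ⁿ`. -/
theorem inner_op_mul_exp_le (hF : 0 ≤ F) (hF1 : ‖F‖ = 1) (hv : Measurable v)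
    (hM : ∀ x, v x ≤ M) {t₀ C : ℝ} (ht₀ : 0 ≤ t₀) (hC : 0 < C)
    (h0 : ∀ g : Lp ℝ 2 μ, (∀ᵐ x ∂μ, g x = F x * Real.exp (v x)) → ⟪P.op t₀ F, g⟫ ≤ C) (n : ℕ) :
    ∀ g : Lp ℝ 2 μ, (∀ᵐ x ∂μ, g x = F x * Real.exp ((1 / 2) ^ n * v x)) →
      ⟪P.op ((1 / 2) ^ n * t₀) F, g⟫ ≤ Real.exp ((1 / 2) ^ n * Real.log C) := by
  induction n with
  | zero =>
    intro g hg
    simp only [pow_zero, one_mul] at hg ⊢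
    rw [Real.exp_log hC]
    exact h0 g hg
  | succ n ih =>
    intro g hg
    set s : ℝ := (1 / 2) ^ (n + 1) with hs
    have hs0 : 0 ≤ s := by positivity
    have hss : (1 / 2 : ℝ) ^ n = s + s := by rw [hs, pow_succ]; ring
    rw [hss, add_mul, add_mul] at ih
    have hst : 0 ≤ s * t₀ := mul_nonneg hs0 ht₀
    have hmem := memLp_mul_exp hv hM (add_nonneg hs0 hs0) F
    set b := hmem.toLp _
    have hb := hmem.coeFn_toLp
    have hF' := (Lp.coeFn_nonneg F).2 hF
    have hbn : 0 ≤ b := by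
      rw [← Lp.coeFn_nonneg]
      filter_upwards [hb, hF'] with x hx hFx
      rw [hx]
      exact mul_nonneg hFx (Real.exp_pos _).le
    have hgn : 0 ≤ g := by
      rw [← Lp.coeFn_nonneg]
      filter_upwards [hg, hF'] with x hx hFx
      rw [hx]
      exact mul_nonneg hFx (Real.exp_pos _).le
    have hsq := P.inner_op_sqrt_le (add_nonneg hst hst) hF hbn hgn (by
      filter_upwards [hb, hg] with x hx hgx
      rw [hx, hgx, add_mul, Real.exp_add]
      ring)
    have hle := hsq.trans (ih b (by filter_upwards [hb] with x hx; rw [hx, add_mul]))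
    rw [P.inner_op_add_self g g hst, real_inner_self_eq_norm_sq, Real.exp_add, ← sq] at hle
    have hnorm : ‖P.op (s * t₀) g‖ ≤ Real.exp (s * Real.log C) :=
      le_of_sq_le_sq hle (Real.exp_pos _).le
    rw [P.symmetric _ hst]
    exact (real_inner_le_norm _ _).trans (by rwa [hF1, one_mul])

theorem inner_op_self_eq {t : ℝ} (ht : 0 < t) (f : Lp ℝ 2 μ) :
    ⟪P.op t f, f⟫ = ‖f‖ ^ 2 - t / 2 * P.approxEnergy f t := by
  rw [approxEnergy, inner_sub_left, real_inner_self_eq_norm_sq]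
  field_simp
  ring

/-- Differentiation of the interpolation inequality at time `0`. -/
theorem inner_le_of_inner_op_mul_exp_le {f : Lp ℝ 2 μ} (hf1 : ‖f‖ = 1) (hv : Measurable v)
    (hM : ∀ x, v x ≤ M) {t₀ C e : ℝ} (ht₀ : 0 < t₀) (hC : 0 < C)
    (he : Tendsto (P.approxEnergy f) (𝓝[>] 0) (𝓝 e))
    (h0 : ∀ g : Lp ℝ 2 μ, (∀ᵐ x ∂μ, g x = |f| x * Real.exp (v x)) → ⟪P.op t₀ |f|, g⟫ ≤ C)
    {k : Lp ℝ 2 μ} (hk : ∀ᵐ x ∂μ, k x = |f| x * v x) :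
    ⟪|f|, k⟫ ≤ t₀ / 2 * e + Real.log C := by
  have hF : 0 ≤ |f| := abs_nonneg f
  have hF1 : ‖|f|‖ = 1 := by rw [norm_abs_eq_norm, hf1]
  have step : ∀ n : ℕ, ⟪P.op ((1 / 2) ^ n * t₀) |f|, k⟫ ≤
      t₀ / 2 * P.approxEnergy f ((1 / 2) ^ n * t₀) +
        (Real.exp ((1 / 2) ^ n * Real.log C) - 1) / (1 / 2) ^ n := by
    intro n
    have hI := P.inner_op_mul_exp_le hF hF1 hv hM ht₀.le hC h0 n
    set s : ℝ := (1 / 2) ^ n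
    have hs : 0 < s := by positivity
    have hst : 0 < s * t₀ := mul_pos hs ht₀
    have hmem := memLp_mul_exp hv hM hs.le |f|
    have hg := hmem.coeFn_toLp
    have hI' := hI _ hg
    have hle : |f| + s • k ≤ hmem.toLp _ := by
      rw [← Lp.coeFn_le]
      filter_upwards [hg, Lp.coeFn_add |f| (s • k), Lp.coeFn_smul s k, hk,
        (Lp.coeFn_nonneg |f|).2 hF] with x h1 h2 h3 h4 h5
      rw [h1, h2, Pi.add_apply, h3, Pi.smul_apply, h4, smul_eq_mul]
      have := mul_le_mul_of_nonneg_left (Real.add_one_le_exp (s * v x)) h5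
      linarith
    have hle' := (inner_le_inner_right (P.positive _ hst.le _ hF) hle).trans hI'
    rw [inner_add_right, inner_smul_right] at hle'
    have habs := P.inner_op_le_inner_op_abs hst.le f
    rw [P.inner_op_self_eq hst, hf1] at habs
    have : s * ⟪P.op (s * t₀) |f|, k⟫ ≤
        s * (t₀ / 2 * P.approxEnergy f (s * t₀)) + (Real.exp (s * Real.log C) - 1) := by
      linarith
    rw [← mul_le_mul_iff_right₀ hs, mul_add, mul_div_cancel₀ _ hs.ne']
    exact this
  have hpow : Tendsto (fun n : ℕ => (1 / 2 : ℝ) ^ n) atTop (𝓝[>] 0) :=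
    tendsto_nhdsWithin_iff.2 ⟨tendsto_pow_atTop_nhds_zero_of_lt_one (by norm_num) (by norm_num),
      Eventually.of_forall fun n => Set.mem_Ioi.2 (by positivity)⟩
  have htime : Tendsto (fun n : ℕ => (1 / 2 : ℝ) ^ n * t₀) atTop (𝓝[>] 0) := by
    refine tendsto_nhdsWithin_iff.2 ⟨?_,
      Eventually.of_forall fun n => Set.mem_Ioi.2 (by positivity)⟩
    simpa using (tendsto_nhdsWithin_iff.1 hpow).1.mul_const t₀
  have hl : Tendsto (fun n : ℕ => ⟪P.op ((1 / 2) ^ n * t₀) |f|, k⟫) atTop (𝓝 ⟪|f|, k⟫) :=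
    ((P.strongly_continuous |f|).comp htime).inner tendsto_const_nhds
  have hexp : Tendsto (fun s : ℝ => (Real.exp (s * Real.log C) - 1) / s) (𝓝[>] 0)
      (𝓝 (Real.log C)) := by
    have hd : HasDerivAt (fun s : ℝ => Real.exp (s * Real.log C)) (Real.log C) 0 := by
      simpa using ((hasDerivAt_id (0 : ℝ)).mul_const (Real.log C)).exp
    have := hd.tendsto_slope_zero_right
    refine this.congr fun s => ?_
    simp [div_eq_inv_mul]
  exact le_of_tendsto_of_tendsto' hl (((he.comp htime).const_mul _).add (hexp.comp hpow)) step

end SymmetricMarkovSemigroup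

variable {τ : ℝ → ℝ}

/-- Hölder's inequality for the normalized pair `(τ, τ*)`. -/
theorem IsAdmissibleYoung.inner_le_of_gaugeNorm_le (hτ : IsAdmissibleYoung τ)
    {u g : Lp ℝ 2 μ} {h : Ω → ℝ} (hint : Integrable (fun x => dual τ (h x)) μ)
    (hh : ∫ x, dual τ (h x) ∂μ ≤ dual τ 1) (hug : ∀ᵐ x ∂μ, u x * g x ≤ u x * h x)
    {C : ℝ} (hC : 0 ≤ C) (hu : gaugeNorm μ τ u ≤ ENNReal.ofReal C) : ⟪u, g⟫ ≤ C := by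
  refine le_of_forall_pos_lt_add fun ε hε => ?_
  have hlt : gaugeNorm μ τ u < ENNReal.ofReal (C + ε) :=
    hu.trans_lt ((ENNReal.ofReal_lt_ofReal_iff (by linarith)).2 (by linarith))
  obtain ⟨_, ⟨k, hk, hmod, rfl⟩, hkC⟩ := sInf_lt_iff.1 hlt
  rw [ENNReal.ofReal_lt_ofReal_iff (by linarith)] at hkC
  refine lt_of_le_of_lt ?_ hkC
  have hmeas : AEStronglyMeasurable (fun x => τ (u x / k)) μ :=
    (hτ.continuous.measurable.comp
      ((Lp.stronglyMeasurable u).measurable.div_const k)).aestronglyMeasurable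
  have hnn : 0 ≤ᵐ[μ] fun x => τ (u x / k) := Eventually.of_forall fun x => hτ.nonneg _
  have hτint : Integrable (fun x => τ (u x / k)) μ :=
    (lintegral_ofReal_ne_top_iff_integrable hmeas hnn).1 (ne_top_of_le_ne_top
      ENNReal.ofReal_ne_top hmod)
  have hτle : ∫ x, τ (u x / k) ∂μ ≤ τ 1 := by
    rw [integral_eq_lintegral_of_nonneg_ae hnn hmeas]
    exact ENNReal.toReal_le_of_le_ofReal (hτ.nonneg 1) hmod
  calc ⟪u, g⟫ = ∫ x, u x * g x ∂μ := inner_eq_integral_mul u g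
    _ ≤ ∫ x, k * (τ (u x / k) + dual τ (h x)) ∂μ := by
      refine integral_mono_ae (integrable_coe_mul_coe u g) ((hτint.add hint).const_mul k) ?_
      filter_upwards [hug] with x hx
      refine hx.trans ?_
      have h1 := mul_le_mul_of_nonneg_left (hτ.young (h x) (u x / k)) hk.le
      have h2 : k * (h x * (u x / k)) = u x * h x := by field_simp
      linarith
    _ = k * (∫ x, τ (u x / k) ∂μ + ∫ x, dual τ (h x) ∂μ) := by
      rw [integral_const_mul, integral_add hτint hint]
    _ ≤ k * 1 := by
      gcongr
      rw [← hτ.normalized]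
      gcongr
    _ = k := mul_one k

theorem logWeight_abs (τ : ℝ → ℝ) (y : ℝ) : logWeight τ |y| = logWeight τ y := by
  simp [logWeight]

namespace SymmetricMarkovSemigroup

variable [IsProbabilityMeasure μ] (P : SymmetricMarkovSemigroup μ)

theorem inner_min_logWeight_le (hτ : IsAdmissibleYoung τ) {f : Lp ℝ 2 μ} (hf1 : ‖f‖ = 1)
    {t₀ C e M : ℝ} (ht₀ : 0 < t₀) (hC : 0 < C)
    (he : Tendsto (P.approxEnergy f) (𝓝[>] 0) (𝓝 e))
    (hgauge : gaugeNorm μ τ (P.op t₀ |f|) ≤ ENNReal.ofReal C) (hM : 0 ≤ M) :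
    Integrable (fun x => f x ^ 2 * min (logWeight τ (f x)) M) μ ∧
      ∫ x, f x ^ 2 * min (logWeight τ (f x)) M ∂μ ≤ t₀ / 2 * e + Real.log C := by
  have hF : 0 ≤ |f| := abs_nonneg f
  have hfabs := Lp.coeFn_abs f
  have hd := hτ.dual_one_pos
  set v : Ω → ℝ := fun x => min (logWeight τ (f x)) M with hv
  have hvm : Measurable v :=
    (hτ.measurable_logWeight.comp (Lp.stronglyMeasurable f).measurable).min measurable_const
  obtain ⟨K, hK0, hK⟩ := hτ.exists_le_mul_min_logWeight
  have hmem : MemLp (fun x => |f| x * v x) 2 μ := by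
    have hdom : MemLp (fun x => (K + M) * |f| x + 1) 2 μ :=
      ((Lp.memLp |f|).const_mul (K + M)).add (memLp_const 1)
    refine hdom.mono ((Lp.aestronglyMeasurable |f|).mul hvm.aestronglyMeasurable) ?_
    filter_upwards [hfabs] with x hx
    simp only [hx, hv]
    rw [← logWeight_abs τ (f x), Real.norm_eq_abs, Real.norm_eq_abs]
    exact (IsAdmissibleYoung.abs_mul_min_logWeight_le hK hK0 hM (abs_nonneg _)).trans
      (le_abs_self _)
  have hk := hmem.coeFn_toLp
  have hae : ∀ᵐ x ∂μ, |f| x * hmem.toLp _ x = f x ^ 2 * v x := by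
    filter_upwards [hk, hfabs] with x h1 h2
    rw [h1, h2, ← mul_assoc, ← sq, sq_abs]
  refine ⟨(integrable_coe_mul_coe _ _).congr hae, ?_⟩
  rw [← integral_congr_ae hae, ← inner_eq_integral_mul]
  refine P.inner_le_of_inner_op_mul_exp_le hf1 hvm (fun x => min_le_right _ _) ht₀ hC he ?_ hk
  intro g hg
  have hdual : ∀ x, dual τ (dualInv τ (dual τ 1 * f x ^ 2)) = dual τ 1 * (f x * f x) := by
    intro x
    rw [hτ.dual_dualInv (by positivity), sq]
  refine hτ.inner_le_of_gaugeNorm_le (h := fun x => dualInv τ (dual τ 1 * f x ^ 2))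
    ?_ ?_ ?_ hC.le hgauge
  · simp only [hdual]
    exact (integrable_coe_mul_coe f f).const_mul _
  · simp only [hdual]
    rw [integral_const_mul, ← inner_eq_integral_mul, real_inner_self_eq_norm_sq, hf1]
    simp
  · filter_upwards [hg, hfabs, (Lp.coeFn_nonneg _).2 (P.positive t₀ ht₀.le _ hF)] with x h1 h2 h3
    refine mul_le_mul_of_nonneg_left ?_ h3
    rw [h1, h2]
    rcases (abs_nonneg (f x)).eq_or_lt with h0 | h0
    · rw [← h0, zero_mul]
      exact hτ.dualInv_nonneg (by positivity)
    · rw [← sq_abs (f x), ← hτ.mul_exp_logWeight h0, logWeight_abs]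
      gcongr
      exact min_le_left _ _

theorem tauEntropy_le_of_norm_eq_one (hτ : IsAdmissibleYoung τ) {f : Lp ℝ 2 μ} (hf1 : ‖f‖ = 1)
    {t₀ C e : ℝ} (ht₀ : 0 < t₀) (hC : 0 < C)
    (he : Tendsto (P.approxEnergy f) (𝓝[>] 0) (𝓝 e))
    (hgauge : gaugeNorm μ τ (P.op t₀ |f|) ≤ ENNReal.ofReal C) :
    Integrable (entIntegrand τ f) μ ∧ tauEntropy τ f ≤ t₀ / 2 * e + Real.log C := by
  set u : ℕ → Ω → ℝ := fun n x => f x ^ 2 * min (logWeight τ (f x)) n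
  have hu : ∀ n, Integrable (u n) μ ∧ ∫ x, u n x ∂μ ≤ t₀ / 2 * e + Real.log C := fun n =>
    P.inner_min_logWeight_le hτ hf1 ht₀ hC he hgauge n.cast_nonneg
  have hent : entIntegrand τ f = fun x => f x ^ 2 * logWeight τ (f x) := by
    funext x
    simp [entIntegrand, hf1]
  have hmono : ∀ x, Monotone fun n => u n x := fun x m n hmn => by
    dsimp only [u]
    gcongr
  have hlim : ∀ x, Tendsto (fun n => u n x) atTop (𝓝 (entIntegrand τ f x)) := by
    intro x
    obtain ⟨N, hN⟩ := exists_nat_ge (logWeight τ (f x))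
    refine tendsto_const_nhds.congr' ?_
    filter_upwards [eventually_ge_atTop N] with n hn
    rw [hent]
    dsimp only [u]
    rw [min_eq_left (hN.trans (by exact_mod_cast hn))]
  have hint : Integrable (entIntegrand τ f) μ := by
    have hm : Measurable (entIntegrand τ f) := by
      rw [hent]
      have := (Lp.stronglyMeasurable f).measurable
      exact (this.pow_const 2).mul (hτ.measurable_logWeight.comp this)
    have hbound : ∀ n, ∫⁻ x, ‖u n x - u 0 x‖ₑ ∂μ ≤
        ENNReal.ofReal (t₀ / 2 * e + Real.log C - ∫ x, u 0 x ∂μ) := by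
      intro n
      have hsub : Integrable (fun x => u n x - u 0 x) μ := (hu n).1.sub (hu 0).1
      rw [← ofReal_integral_norm_eq_lintegral_enorm hsub]
      refine ENNReal.ofReal_le_ofReal ?_
      have : ∀ x, ‖u n x - u 0 x‖ = u n x - u 0 x := fun x =>
        Real.norm_of_nonneg (sub_nonneg.2 (hmono x n.zero_le))
      simp only [this]
      rw [integral_sub (hu n).1 (hu 0).1]
      exact sub_le_sub_right (hu n).2 _
    have hdiff : Integrable (fun x => entIntegrand τ f x - u 0 x) μ := by
      refine ⟨hm.aestronglyMeasurable.sub (hu 0).1.aestronglyMeasurable, ?_⟩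
      have hF : ∫⁻ x, ‖entIntegrand τ f x - u 0 x‖ₑ ∂μ ≤
          liminf (fun n => ∫⁻ x, ‖u n x - u 0 x‖ₑ ∂μ) atTop := by
        refine le_trans (lintegral_mono fun x => ?_) (lintegral_liminf_le' fun n =>
          ((hu n).1.sub (hu 0).1).aestronglyMeasurable.aemeasurable.enorm)
        exact ((hlim x).sub_const (u 0 x)).enorm.liminf_eq.ge
      refine hF.trans_lt ?_
      refine lt_of_le_of_lt (liminf_le_liminf (Eventually.of_forall hbound)) ?_
      rw [liminf_const]
      exact ENNReal.ofReal_lt_top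
    refine (hdiff.add (hu 0).1).congr (Eventually.of_forall fun x => ?_)
    simp
  refine ⟨hint, ?_⟩
  exact le_of_tendsto' (integral_tendsto_of_tendsto_of_monotone (fun n => (hu n).1) hint
    (Eventually.of_forall hmono) (Eventually.of_forall hlim)) fun n => (hu n).2

theorem approxEnergy_smul (c : ℝ) (f : Lp ℝ 2 μ) (t : ℝ) :
    P.approxEnergy (c • f) t = c ^ 2 * P.approxEnergy f t := by
  simp only [approxEnergy, map_smul, ← smul_sub, inner_smul_left, inner_smul_right,
    conj_trivial]
  ring

theorem tauEntropy_le (hτ : IsAdmissibleYoung τ) {t₀ C : ℝ} (ht₀ : 0 < t₀) (hC : 0 < C)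
    (hgauge : ∀ f : Lp ℝ 2 μ, ‖f‖ = 1 → gaugeNorm μ τ (P.op t₀ f) ≤ ENNReal.ofReal C)
    {f : Lp ℝ 2 μ} (hf : f ∈ P.energyDomain) :
    Integrable (entIntegrand τ f) μ ∧
      tauEntropy τ f ≤ t₀ / 2 * P.energy f + Real.log C * ‖f‖ ^ 2 := by
  obtain ⟨e, he⟩ := hf
  have hen : P.energy f = e := he.limUnder_eq
  rw [hen]
  rcases eq_or_ne f 0 with rfl | hf0
  · have he0 : e = 0 := tendsto_nhds_unique he (by
      have : P.approxEnergy (0 : Lp ℝ 2 μ) = fun _ => 0 := by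
        funext t
        simp [approxEnergy]
      rw [this]
      exact tendsto_const_nhds)
    have hz : entIntegrand τ (0 : Lp ℝ 2 μ) =ᵐ[μ] fun _ => 0 := by
      filter_upwards [Lp.coeFn_zero ℝ 2 μ] with x hx
      rw [entIntegrand, hx, Pi.zero_apply]
      ring
    refine ⟨(integrable_zero _ _ _).congr hz.symm, ?_⟩
    rw [tauEntropy, integral_congr_ae hz, he0]
    simp
  have hpos : 0 < ‖f‖ := norm_pos_iff.2 hf0
  set g : Lp ℝ 2 μ := ‖f‖⁻¹ • f with hg
  have hg1 : ‖g‖ = 1 := by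
    rw [hg, norm_smul, norm_inv, norm_norm, inv_mul_cancel₀ hpos.ne']
  have heg : Tendsto (P.approxEnergy g) (𝓝[>] 0) (𝓝 (‖f‖⁻¹ ^ 2 * e)) :=
    (he.const_mul (‖f‖⁻¹ ^ 2)).congr fun t => (P.approxEnergy_smul _ f t).symm
  obtain ⟨hint, hle⟩ := P.tauEntropy_le_of_norm_eq_one hτ hg1 ht₀ hC heg
    (hgauge |g| (by rw [norm_abs_eq_norm, hg1]))
  have hae : (fun x => ‖f‖ ^ 2 * entIntegrand τ g x) =ᵐ[μ] entIntegrand τ f := by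
    filter_upwards [Lp.coeFn_smul ‖f‖⁻¹ f] with x hx
    have hgx : g x = f x / ‖f‖ := by
      rw [hx, Pi.smul_apply, smul_eq_mul, inv_mul_eq_div]
    rw [entIntegrand, entIntegrand, hg1, div_one, hgx]
    field_simp
  refine ⟨(hint.const_mul _).congr hae, ?_⟩
  rw [tauEntropy, ← integral_congr_ae hae, integral_const_mul]
  calc ‖f‖ ^ 2 * tauEntropy τ g ≤ ‖f‖ ^ 2 * (t₀ / 2 * (‖f‖⁻¹ ^ 2 * e) + Real.log C) := by gcongr
    _ = _ := by field_simp

theorem one_le_gaugeNorm_op_one (hτ : IsAdmissibleYoung τ) {t : ℝ} (ht : 0 ≤ t) :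
    1 ≤ gaugeNorm μ τ (P.op t (Lp.const 2 μ (1 : ℝ))) := by
  rw [P.conservative t ht]
  refine le_sInf ?_
  rintro _ ⟨k, hk, hmod, rfl⟩
  rw [ENNReal.one_le_ofReal]
  have hconst : modular μ τ (fun x => (Lp.const 2 μ (1 : ℝ)) x / k) =
      ENNReal.ofReal (τ (1 / k)) := by
    rw [modular, lintegral_congr_ae (g := fun _ => ENNReal.ofReal (τ (1 / k)))]
    · simp
    · filter_upwards [Lp.coeFn_const (p := 2) (μ := μ) (1 : ℝ)] with x hx
      rw [hx, Function.const_apply]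
  rw [hconst, ENNReal.ofReal_le_ofReal_iff (hτ.nonneg 1),
    hτ.strictMono.le_iff_le (Set.mem_Ici.2 (by positivity)) (Set.mem_Ici.2 zero_le_one),
    div_le_one hk] at hmod
  exact hmod

theorem gaugeNorm_op_le_orliczOpNorm (t : ℝ) {f : Lp ℝ 2 μ} (hf : ‖f‖ = 1) :
    gaugeNorm μ τ (P.op t f) ≤ orliczOpNorm τ (P.op t) :=
  le_sInf fun C hC => by simpa [hf] using hC f

theorem one_le_orliczOpNorm (hτ : IsAdmissibleYoung τ) {t : ℝ} (ht : 0 ≤ t) :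
    1 ≤ orliczOpNorm τ (P.op t) :=
  (P.one_le_gaugeNorm_op_one hτ ht).trans
    (P.gaugeNorm_op_le_orliczOpNorm t (by simp [Lp.norm_const]))

end SymmetricMarkovSemigroup

end OrliczSobolev

theorem theorem4p3 {Ω : Type*} [MeasurableSpace Ω] (μ : Measure Ω) [IsProbabilityMeasure μ]
    (τ : ℝ → ℝ) (hτ : OrliczSobolev.IsAdmissibleYoung τ)
    (hext : ∃ l : ℝ, Tendsto (fun y : ℝ => y ^ 2 * OrliczSobolev.logWeight τ y) (𝓝[≠] 0) (𝓝 l))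
    (P : OrliczSobolev.SymmetricMarkovSemigroup μ) (t₀ : ℝ) (ht₀ : 0 < t₀) :
    (P.OrliczHyperboundedAt τ t₀ →
      ∀ f ∈ P.energyDomain,
        Integrable (OrliczSobolev.entIntegrand τ f) μ ∧
        OrliczSobolev.tauEntropy τ f ≤ t₀ / 2 * P.energy f +
          Real.log (OrliczSobolev.orliczOpNorm τ (P.op t₀)).toReal * ‖f‖ ^ 2) ∧
    (P.OrliczHypercontractiveAt τ t₀ →
      ∀ f ∈ P.energyDomain,
        Integrable (OrliczSobolev.entIntegrand τ f) μ ∧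
        OrliczSobolev.tauEntropy τ f ≤ t₀ / 2 * P.energy f) := by
  refine ⟨fun h f hf => ?_, fun h f hf => ?_⟩
  · have h1 := P.one_le_orliczOpNorm hτ ht₀.le
    refine P.tauEntropy_le hτ ht₀ (ENNReal.toReal_pos (one_pos.trans_le h1).ne' h.2.ne)
      (fun f hf => ?_) hf
    rw [ENNReal.ofReal_toReal h.2.ne]
    exact P.gaugeNorm_op_le_orliczOpNorm t₀ hf
  · simpa using P.tauEntropy_le hτ ht₀ one_pos (fun f hf => by simpa [hf] using h.2 f) hf
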